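/- For triple systems (3-uniform hypergraphs) $F,G$ let $r(F,G)$ be the minimum $n$ such that every red/blue coloring of the triples of an $n$-element set contains a red copy of $F$ or a blue copy of $G$. Let $K_t^3$ be the complete triple system on $t$ vertices, and let $K_5^{3-}$ be $K_5^3$ with one edge deleted. Let $K_4^-$ be the ordered graph with vertices $v_1<v_2<v_3<v_4$ and all edges except $v_3v_4$. The vertex on-line ordered Ramsey game is played by builder and painter. At step $i+1$ a new vertex $v_{i+1}$ is revealed; then, for $j=1,\dots,i$ in order, builder decides whether to draw the edge $v_jv_{i+1}$, and if he draws it, painter immediately colors it red or blue. Copies of $K_4^-$ in the resulting graph must respect the order in which the vertices were revealed. There is an absolute constant $C>0$ such that the following holds for all integers $t\ge 2$ and $\ell,a,m\ge 0$. Suppose that builder has a strategy in this game which, however painter plays, ensures a red $K_4^-$ or a blue $K_{t-1}$ using at most $\ell$ vertices, at most $a$ red edges, and at most $m$ edges in total. Then, for every real $\alpha$ with $0<\alpha<1/2$, the Ramsey number $r(K_5^{3-},K_t^3)$ exists and satisfies $$r(K_5^{3-},K_t^3)\le C\,\ell\,\alpha^{-a}(1-\alpha)^{a-m}.$$ -/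

import Mathlib

/-- The two colours used by the painter and in Ramsey numbers. -/
inductive Color where
  | red
  | blue
  deriving DecidableEq

namespace HypergraphRamsey

/-- A `k`-uniform hypergraph on `V`: a collection of `k`-element subsets of `V`. -/
structure KGraph (k : ℕ) (V : Type) where
  /-- the edges -/
  edges : Set (Finset V)
  /-- every edge has exactly `k` elements -/
  uniform : ∀ e ∈ edges, e.card = k

/-- The complete `k`-uniform hypergraph on `t` vertices. -/
def complete (k t : ℕ) : KGraph k (Fin t) where
  edges := {e | e.card = k}
  uniform := fun _ he => he

/-- The triple system obtained from the complete triple system on five vertices by deleting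
one edge. -/
def K5minus : KGraph 3 (Fin 5) where
  edges := {e | e.card = 3 ∧ e ≠ {2, 3, 4}}
  uniform := fun _ he => he.1

/-- A red/blue colouring of the edges of the complete `k`-uniform hypergraph on `n` vertices. -/
abbrev Coloring (k n : ℕ) : Type := {e : Finset (Fin n) // e.card = k} → Color

/-- The colouring `χ` has a copy of `F` all of whose edges have colour `c`. -/
def HasMonoCopy {k n : ℕ} {V : Type} (χ : Coloring k n) (c : Color) (F : KGraph k V) : Prop :=
  ∃ f : V ↪ Fin n, ∀ (e : Finset V) (he : e ∈ F.edges),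
    χ ⟨e.map f, (Finset.card_map f).trans (F.uniform e he)⟩ = c

/-- Every red/blue colouring of the complete `k`-uniform hypergraph on `n` vertices has a red copy
of `F` or a blue copy of `G`. -/
def Arrows {k : ℕ} {V W : Type} (n : ℕ) (F : KGraph k V) (G : KGraph k W) : Prop :=
  ∀ χ : Coloring k n, HasMonoCopy χ Color.red F ∨ HasMonoCopy χ Color.blue G

/-- The Ramsey number `r(F, G)`, the least `n` with `Arrows n F G` (and `0` if there is none). -/
noncomputable def ramseyNumber {k : ℕ} {V W : Type} (F : KGraph k V) (G : KGraph k W) : ℕ :=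
  sInf {n | Arrows n F G}

end HypergraphRamsey

namespace OnlineGame

/-- A position of the vertex on-line ordered game. The vertices revealed so far are
`0, 1, …, vertices - 1`, in this order. The pairs `(j, vertices - 1)` with `j < next`, and all pairs
of earlier vertices, have already been decided upon. For `j < i`, `color j i` is `none` if the edge
`ji` has not been drawn, and otherwise it is the colour which painter gave it. As the pairs are
decided upon in a fixed order, a position records the whole course of the game. -/
structure Position where
  /-- the number of vertices revealed so far -/
  vertices : ℕ
  /-- the earlier vertex whose edge to the newest vertex is the next to be decided upon -/
  next : ℕ
  /-- the edges drawn so far, with their colours -/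
  color : ℕ → ℕ → Option Color

/-- The position at the start: no vertices and no edges. -/
def start : Position := ⟨0, 0, fun _ _ => none⟩

/-- A strategy of builder: whether to draw the edge between `next` and the newest vertex. -/
abbrev Builder : Type := Position → Bool

/-- A strategy of painter: the colour of the edge between `next` and the newest vertex, which
builder has just drawn. -/
abbrev Painter : Type := Position → Color

/-- One move. If some earlier vertex is still to be decided upon for the newest vertex, then builder
decides whether to draw the edge to it, and painter colours the edge if it is drawn. Otherwise a new
vertex is revealed. -/
def step (σ : Builder) (τ : Painter) (p : Position) : Position :=
  if p.next + 1 < p.vertices then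
    { vertices := p.vertices
      next := p.next + 1
      color := fun j i =>
        if j = p.next ∧ i + 1 = p.vertices then
          (if σ p = true then some (τ p) else none)
        else p.color j i }
  else
    { vertices := p.vertices + 1
      next := 0
      color := p.color }

/-- The position after `n` moves. -/
def play (σ : Builder) (τ : Painter) (n : ℕ) : Position := (step σ τ)^[n] start

/-- The number of edges of colour `c` that have been drawn. -/
def Position.numColor (p : Position) (c : Color) : ℕ :=
  ((Finset.range p.vertices ×ˢ Finset.range p.vertices).filter
    (fun e => e.1 < e.2 ∧ p.color e.1 e.2 = some c)).card

/-- The total number of edges that have been drawn. -/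
def Position.numEdges (p : Position) : ℕ :=
  ((Finset.range p.vertices ×ˢ Finset.range p.vertices).filter
    (fun e => e.1 < e.2 ∧ p.color e.1 e.2 ≠ none)).card

/-- The position has a copy of the ordered graph `F` (with the usual order of `Fin k`) all of whose
edges have been drawn and have colour `c`; vertices are ordered as they were revealed. -/
def Position.HasOrderedCopy (p : Position) (c : Color) {k : ℕ} (F : SimpleGraph (Fin k)) : Prop :=
  ∃ f : Fin k → ℕ, StrictMono f ∧ (∀ x, f x < p.vertices) ∧
    ∀ x y, x < y → F.Adj x y → p.color (f x) (f y) = some c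

/-- The ordered graph on four vertices with all edges except the one between the last two. -/
def K4minus : SimpleGraph (Fin 4) := (⊤ : SimpleGraph (Fin 4)).deleteEdges {s(2, 3)}

/-- Builder has a strategy which, whatever painter does, ensures a red ordered copy of `F` or a blue
complete graph on `s` vertices using at most `ℓ` vertices, `a` red edges and `m` edges in total. -/
def BuilderEnsures {k : ℕ} (F : SimpleGraph (Fin k)) (s ℓ a m : ℕ) : Prop :=
  ∃ σ : Builder, ∀ τ : Painter, ∃ n : ℕ,
    ((play σ τ n).HasOrderedCopy Color.red F ∨
      (play σ τ n).HasOrderedCopy Color.blue (⊤ : SimpleGraph (Fin s))) ∧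
    (play σ τ n).vertices ≤ ℓ ∧
    (play σ τ n).numColor Color.red ≤ a ∧
    (play σ τ n).numEdges ≤ m

end OnlineGame

/-!
Painter simulates the game inside a coloured complete triple system on `V`. Each revealed vertex is
mapped to an actual vertex `v i ∈ V`, and painter keeps alive the set of *candidates*: the vertices
`w` such that for every drawn edge `ji` the triple `v j, v i, w` has the colour of `ji`. When an
edge is drawn, either at least a proportion `α` of the candidates is compatible with red or at least
a proportion `1 - α` is compatible with blue, and painter answers accordingly; revealing a vertex
uses up one candidate. As `α ≤ 1 - α`, the proportion surviving the edges is smallest when builder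
uses up his `a` red edges and all `m` edges. If `|V| α ^ a (1 - α) ^ (m - a) > ℓ`, then a candidate
is left when builder has forced his ordered graph, and adjoining it as a last vertex turns that
graph into the triple system whose edges have their two least vertices adjacent in the graph.
-/

namespace OnlineGame

open Finset

namespace Position

/-- The position after a new vertex is revealed. -/
def reveal (p : Position) : Position where
  vertices := p.vertices + 1
  next := 0
  color := p.color

/-- The position after the pair to be decided upon gets the status `o`: it is not drawn if `o` is
`none`, and it is drawn with colour `d` if `o` is `some d`. -/
def record (p : Position) (o : Option Color) : Position where
  vertices := p.vertices
  next := p.next + 1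
  color := fun j i => if j = p.next ∧ i + 1 = p.vertices then o else p.color j i

/-- Pairs that have not been decided upon yet carry no colour. This holds for all positions that
occur in a game, but not for arbitrary terms of type `Position`. -/
def WellFormed (p : Position) : Prop :=
  ∀ j i, p.vertices ≤ i ∨ i + 1 = p.vertices ∧ p.next ≤ j → p.color j i = none

theorem WellFormed.reveal {p : Position} (hp : p.WellFormed) : p.reveal.WellFormed := by
  intro j i hi
  simp only [Position.reveal] at hi ⊢
  exact hp j i (by omega)

theorem WellFormed.record {p : Position} (hp : p.WellFormed) (o : Option Color) :
    (p.record o).WellFormed := by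
  intro j i hi
  simp only [Position.record] at hi ⊢
  rw [if_neg (by omega)]
  exact hp j i (by omega)

theorem WellFormed.record_none {p : Position} (hp : p.WellFormed) :
    p.record none = { p with next := p.next + 1 } := by
  simp only [Position.record, mk.injEq, true_and]
  funext j i
  split_ifs with h
  · exact (hp j i (.inr ⟨h.2, h.1.ge⟩)).symm
  · rfl

theorem WellFormed.numColor_reveal {p : Position} (hp : p.WellFormed) (d : Color) :
    p.reveal.numColor d = p.numColor d := by
  unfold numColor
  congr 1
  ext ⟨j, i⟩
  have hnew : p.color j p.vertices = none := hp _ _ (.inl le_rfl)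
  simp only [mem_filter, mem_product, mem_range, Position.reveal]
  grind

theorem WellFormed.numColor_record_some {p : Position} (hp : p.WellFormed)
    (h : p.next + 1 < p.vertices) (d d' : Color) :
    (p.record (some d)).numColor d' = p.numColor d' + if d = d' then 1 else 0 := by
  have hpair : p.color p.next (p.vertices - 1) = none := hp _ _ (.inr ⟨by omega, le_rfl⟩)
  unfold numColor
  split_ifs with hd
  · rw [← card_insert_of_notMem (a := (p.next, p.vertices - 1)) (by simp [hpair])]
    congr 1
    ext ⟨j, i⟩
    simp only [mem_insert, mem_filter, mem_product, mem_range, Position.record,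
      Prod.mk.injEq]
    grind
  · rw [add_zero]
    congr 1
    ext ⟨j, i⟩
    simp only [mem_filter, mem_product, mem_range, Position.record]
    grind

theorem numColor_red_add_numColor_blue (p : Position) :
    p.numColor .red + p.numColor .blue = p.numEdges := by
  unfold numColor numEdges
  rw [← card_union_of_disjoint (disjoint_filter.2 fun e _ hr hb => by simp [hr.2] at hb),
    ← filter_or]
  congr 2
  funext e
  rcases p.color e.1 e.2 with _ | _ | _ <;> simp

end Position

theorem play_succ (σ : Builder) (τ : Painter) (n : ℕ) :
    play σ τ (n + 1) = step σ τ (play σ τ n) :=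
  Function.iterate_succ_apply' _ _ _

theorem step_eq_ite (σ : Builder) (τ : Painter) (p : Position) :
    step σ τ p = if p.next + 1 < p.vertices then
      p.record (if σ p = true then some (τ p) else none) else p.reveal :=
  rfl

theorem wellFormed_play (σ : Builder) (τ : Painter) (n : ℕ) : (play σ τ n).WellFormed := by
  induction n with
  | zero => exact fun _ _ _ => rfl
  | succ n ih =>
    rw [play_succ, step_eq_ite]
    split_ifs
    exacts [ih.record _, ih.record _, ih.reveal]

theorem exists_painter_forall_play {P : Position → Prop} (hstart : P start)
    (hreveal : ∀ p : Position, p.WellFormed → P p → P p.reveal)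
    (hskip : ∀ p : Position, p.WellFormed → P p → P (p.record none))
    (hdraw : ∀ p : Position, p.WellFormed → P p → p.next + 1 < p.vertices →
      ∃ d, P (p.record (some d))) :
    ∃ τ : Painter, ∀ σ n, P (play σ τ n) := by
  have : Nonempty Color := ⟨.red⟩
  choose! τ hτ using hdraw
  refine ⟨τ, fun σ n => ?_⟩
  induction n with
  | zero => exact hstart
  | succ n ih =>
    have hp := wellFormed_play σ τ n
    rw [play_succ, step_eq_ite]
    split_ifs with h
    exacts [hτ _ hp ih h, hskip _ hp ih, hreveal _ hp ih]

theorem BuilderEnsures.vertices_pos {k s ℓ a m : ℕ} {F : SimpleGraph (Fin k)} (hk : 0 < k)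
    (hs : 0 < s) (h : BuilderEnsures F s ℓ a m) : 0 < ℓ := by
  obtain ⟨σ, hσ⟩ := h
  obtain ⟨n, ⟨f, -, hf, -⟩ | ⟨f, -, hf, -⟩, hℓ, -⟩ := hσ fun _ => .red
  · exact (Nat.zero_le _).trans_lt ((hf ⟨0, hk⟩).trans_le hℓ)
  · exact (Nat.zero_le _).trans_lt ((hf ⟨0, hs⟩).trans_le hℓ)

/-- The proportion of the candidates that painter insists on keeping when he uses a colour. -/
def share (α : ℝ) : Color → ℝ
  | .red => α
  | .blue => 1 - α

theorem share_nonneg {α : ℝ} (h0 : 0 ≤ α) (h1 : α ≤ 1) : ∀ d, 0 ≤ share α d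
  | .red => h0
  | .blue => sub_nonneg.2 h1

theorem share_le_one {α : ℝ} (h0 : 0 ≤ α) (h1 : α ≤ 1) : ∀ d, share α d ≤ 1
  | .red => h1
  | .blue => sub_le_self 1 h0

theorem exists_share_mul_card_le {V : Type*} (α : ℝ) (A : Finset V) (f : V → Color) :
    ∃ d, share α d * #A ≤ #{w ∈ A | f w = d} := by
  by_contra! hlt
  have hsplit : (#{w ∈ A | f w = .red} : ℝ) + #{w ∈ A | f w = .blue} = #A := by
    rw [← card_filter_add_card_filter_not (s := A) (fun w => f w = .red), Nat.cast_add]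
    congr 3
    exact filter_congr fun w _ => by cases f w <;> simp
  have hred := hlt .red
  have hblue := hlt .blue
  simp only [share] at hred hblue
  linarith

/-- The proportion of the candidates that is guaranteed to survive the edges drawn so far. -/
noncomputable def Position.weight (α : ℝ) (p : Position) : ℝ :=
  α ^ p.numColor .red * (1 - α) ^ p.numColor .blue

theorem Position.weight_nonneg {α : ℝ} (h0 : 0 ≤ α) (h1 : α ≤ 1) (p : Position) :
    0 ≤ p.weight α :=
  mul_nonneg (pow_nonneg h0 _) (pow_nonneg (sub_nonneg.2 h1) _)

theorem Position.WellFormed.weight_reveal {p : Position} (hp : p.WellFormed) (α : ℝ) :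
    p.reveal.weight α = p.weight α := by
  simp only [weight, hp.numColor_reveal]

theorem Position.WellFormed.weight_record_some {p : Position} (hp : p.WellFormed)
    (h : p.next + 1 < p.vertices) (α : ℝ) (d : Color) :
    (p.record (some d)).weight α = share α d * p.weight α := by
  cases d <;> simp only [weight, share, hp.numColor_record_some h, reduceCtorEq, if_true, if_false]
    <;> ring

theorem div_one_sub_le_one {α : ℝ} (h : α ≤ 1 / 2) : α / (1 - α) ≤ 1 :=
  (div_le_one (by linarith)).2 (by linarith)

theorem Position.le_weight {p : Position} {a m : ℕ} {α : ℝ} (h0 : 0 ≤ α) (h1 : α ≤ 1 / 2)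
    (ha : p.numColor .red ≤ a) (hm : p.numEdges ≤ m) :
    (α / (1 - α)) ^ a * (1 - α) ^ m ≤ p.weight α := by
  have hβ : 0 < 1 - α := by linarith
  have hweight : p.weight α = (α / (1 - α)) ^ p.numColor .red * (1 - α) ^ p.numEdges := by
    rw [weight, ← numColor_red_add_numColor_blue, div_pow, pow_add]
    field_simp
  rw [hweight]
  exact mul_le_mul
    (pow_le_pow_of_le_one (by positivity) (div_one_sub_le_one h1) ha)
    (pow_le_pow_of_le_one hβ.le (by linarith) hm) (by positivity) (by positivity)

section Candidates

variable {V : Type*} [Fintype V] [DecidableEq V] {T : Finset V → Color}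
  {c c' : ℕ → ℕ → Option Color} {v v' : ℕ → V} {k : ℕ} {w : V}

/-- The vertices `w` that can follow `v 0, …, v (k - 1)`: they are new, and whenever `j < i < k`
and the pair `ji` has a colour under `c`, the triple `v j, v i, w` has the same colour under `T`. -/
def candidates (T : Finset V → Color) (c : ℕ → ℕ → Option Color) (v : ℕ → V) (k : ℕ) : Finset V :=
  {w | ∀ i < k, v i ≠ w ∧ ∀ j < i, ∀ d ∈ c j i, T {v j, v i, w} = d}

theorem mem_candidates : w ∈ candidates T c v k ↔
    ∀ i < k, v i ≠ w ∧ ∀ j < i, ∀ d ∈ c j i, T {v j, v i, w} = d := by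
  simp [candidates]

theorem candidates_congr (hv : ∀ i < k, v i = v' i) (hc : ∀ i < k, ∀ j < i, c j i = c' j i) :
    candidates T c v k = candidates T c' v' k := by
  ext w
  simp only [mem_candidates]
  refine forall₂_congr fun i hi => ?_
  rw [hv i hi]
  refine and_congr_right fun _ => forall₂_congr fun j hj => ?_
  rw [hc i hi j hj, hv j (hj.trans hi)]

theorem erase_subset_candidates_succ (hc : ∀ j < k, c j k = none) :
    (candidates T c v k).erase (v k) ⊆ candidates T c v (k + 1) := by
  intro w hw
  obtain ⟨hne, hw⟩ := mem_erase.1 hw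
  refine mem_candidates.2 fun i hi => ?_
  obtain hi | rfl := Nat.lt_succ_iff_lt_or_eq.1 hi
  · exact mem_candidates.1 hw i hi
  · exact ⟨hne.symm, fun j hj d hd => by simp [hc j hj] at hd⟩

/-- The vertices `v 0, …, v (k - 1)` of `V` can take the place of the first `k` vertices of the
game: each of them is a candidate with respect to its predecessors. -/
def Realizes (T : Finset V → Color) (c : ℕ → ℕ → Option Color) (v : ℕ → V) (k : ℕ) : Prop :=
  ∀ i < k, v i ∈ candidates T c v i

theorem Realizes.ne (h : Realizes T c v k) {i j : ℕ} (hji : j < i) (hi : i < k) : v j ≠ v i :=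
  (mem_candidates.1 (h i hi) j hji).1

theorem Realizes.color_eq (h : Realizes T c v k) {i j l : ℕ} {d : Color} (hji : j < i) (hil : i < l)
    (hl : l < k) (hd : c j i = some d) : T {v j, v i, v l} = d :=
  (mem_candidates.1 (h l hl) i hil).2 j hji d hd

theorem Realizes.exists_extension (h : Realizes T c v k) (hw : w ∈ candidates T c v k) :
    ∃ v', Realizes T c v' (k + 1) ∧ candidates T c v' k = candidates T c v k := by
  have hagree : ∀ i < k, Function.update v k w i = v i := fun i hi =>
    Function.update_of_ne hi.ne _ _
  have hcand : ∀ i ≤ k, candidates T c (Function.update v k w) i = candidates T c v i :=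
    fun i hi => candidates_congr (fun j hj => hagree j (hj.trans_le hi)) fun _ _ _ _ => rfl
  refine ⟨Function.update v k w, fun i hi => ?_, hcand k le_rfl⟩
  rw [hcand i (Nat.le_of_lt_succ hi)]
  obtain hi | rfl := Nat.lt_succ_iff_lt_or_eq.1 hi
  · rw [hagree i hi]
    exact h i hi
  · rwa [Function.update_self]

theorem Realizes.record {p : Position} (h : Realizes T p.color v p.vertices) (o : Option Color) :
    Realizes T (p.record o).color v p.vertices := by
  intro i hi
  have hsame : ∀ l < i, ∀ j < l, (p.record o).color j l = p.color j l := fun _ _ _ _ =>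
    if_neg (by omega)
  rw [candidates_congr (fun _ _ => rfl) hsame]
  exact h i hi

theorem Position.filter_candidates_subset_candidates_record (p : Position) (d : Color) :
    {w ∈ candidates T p.color v p.vertices | T {v p.next, v (p.vertices - 1), w} = d} ⊆
      candidates T (p.record (some d)).color v p.vertices := by
  intro w hw
  obtain ⟨hw, hd⟩ := mem_filter.1 hw
  refine mem_candidates.2 fun i hi => ⟨(mem_candidates.1 hw i hi).1, fun j hj d' hd' => ?_⟩
  simp only [record] at hd'
  split_ifs at hd' with hpair
  · obtain rfl : i = p.vertices - 1 := by omega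
    rw [hpair.1, hd]
    exact Option.some.inj hd'
  · exact (mem_candidates.1 hw i hi).2 j hj d' hd'

end Candidates

section Painter

variable {V : Type*} [Fintype V] [DecidableEq V] {T : Finset V → Color} {α : ℝ} {p : Position}

/-- Painter's invariant: the vertices of the game are realized in `V` with as many candidates left
as `weight` promises, up to one for each vertex. Nothing is claimed once this promise has become
void. -/
def Position.Realizable (T : Finset V → Color) (α : ℝ) (p : Position) : Prop :=
  p.vertices < Fintype.card V * p.weight α → ∃ v, Realizes T p.color v p.vertices ∧
    Fintype.card V * p.weight α ≤ #(candidates T p.color v p.vertices) + (p.vertices : ℝ)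

theorem realizable_start (T : Finset V → Color) (α : ℝ) : start.Realizable T α := by
  intro hcard
  have hweight : start.weight α = 1 := by simp [Position.weight, Position.numColor, start]
  simp only [hweight, mul_one] at hcard ⊢
  have hV : 0 < Fintype.card V := by exact_mod_cast (Nat.cast_nonneg _).trans_lt hcard
  obtain ⟨x⟩ := Fintype.card_pos_iff.1 hV
  refine ⟨fun _ => x, fun i hi => absurd hi (Nat.not_lt_zero i), ?_⟩
  simp [candidates, start]

theorem Position.Realizable.exists_realizes_succ (h : p.Realizable T α)
    (hcard : p.vertices < Fintype.card V * p.weight α) :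
    ∃ v, Realizes T p.color v (p.vertices + 1) ∧
      Fintype.card V * p.weight α ≤ #(candidates T p.color v p.vertices) + (p.vertices : ℝ) := by
  obtain ⟨v, hv, hle⟩ := h hcard
  have hpos : 0 < #(candidates T p.color v p.vertices) := by
    rw [← Nat.cast_pos (α := ℝ)]
    linarith
  obtain ⟨w, hw⟩ := card_pos.1 hpos
  obtain ⟨v', hv', heq⟩ := hv.exists_extension hw
  exact ⟨v', hv', by rwa [heq]⟩

theorem Position.Realizable.reveal (h : p.Realizable T α) (hp : p.WellFormed) :
    p.reveal.Realizable T α := by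
  intro hcard
  rw [hp.weight_reveal] at hcard ⊢
  have hcast : (p.reveal.vertices : ℝ) = p.vertices + 1 := Nat.cast_succ _
  obtain ⟨v, hv, hle⟩ := h.exists_realizes_succ (by linarith)
  refine ⟨v, hv, ?_⟩
  have hsub : (candidates T p.color v p.vertices).erase (v p.vertices) ⊆
      candidates T p.reveal.color v p.reveal.vertices :=
    erase_subset_candidates_succ fun j _ => hp j _ (.inl le_rfl)
  have hloss : (#(candidates T p.color v p.vertices) : ℝ) ≤
      #(candidates T p.reveal.color v p.reveal.vertices) + 1 := by
    exact_mod_cast Nat.sub_le_iff_le_add.1 (pred_card_le_card_erase.trans (card_le_card hsub))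
  linarith

theorem Position.Realizable.record_none (h : p.Realizable T α) (hp : p.WellFormed) :
    (p.record none).Realizable T α := by
  rw [hp.record_none]
  exact h

theorem Position.Realizable.exists_record_some (h : p.Realizable T α) (h0 : 0 ≤ α) (h1 : α ≤ 1)
    (hp : p.WellFormed) (hnext : p.next + 1 < p.vertices) :
    ∃ d, (p.record (some d)).Realizable T α := by
  by_cases hcard : p.vertices < Fintype.card V * p.weight α
  · obtain ⟨v, hv, hle⟩ := h hcard
    obtain ⟨d, hd⟩ := exists_share_mul_card_le α (candidates T p.color v p.vertices)
      fun w => T {v p.next, v (p.vertices - 1), w}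
    refine ⟨d, fun _ => ⟨v, hv.record _, ?_⟩⟩
    calc Fintype.card V * (p.record (some d)).weight α
        = share α d * (Fintype.card V * p.weight α) := by
          rw [hp.weight_record_some hnext]
          ring
      _ ≤ share α d * (#(candidates T p.color v p.vertices) + p.vertices) :=
          mul_le_mul_of_nonneg_left hle (share_nonneg h0 h1 d)
      _ = share α d * #(candidates T p.color v p.vertices) + share α d * p.vertices :=
          mul_add _ _ _
      _ ≤ #(candidates T (p.record (some d)).color v p.vertices) + p.vertices :=
          add_le_add
            (hd.trans (Nat.cast_le.2 (card_le_card
              (filter_candidates_subset_candidates_record p d))))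
            (mul_le_of_le_one_left (Nat.cast_nonneg _) (share_le_one h0 h1 d))
  · refine ⟨.red, fun hlt => absurd ?_ hcard⟩
    calc (p.vertices : ℝ) < Fintype.card V * (p.record (some .red)).weight α := hlt
      _ = α * (Fintype.card V * p.weight α) := by
          rw [hp.weight_record_some hnext, share]
          ring
      _ ≤ Fintype.card V * p.weight α :=
          mul_le_of_le_one_left (mul_nonneg (Nat.cast_nonneg _) (p.weight_nonneg h0 h1)) h1

theorem exists_painter_forall_realizable (T : Finset V → Color) (h0 : 0 ≤ α) (h1 : α ≤ 1) :
    ∃ τ : Painter, ∀ σ n, (play σ τ n).Realizable T α :=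
  exists_painter_forall_play (realizable_start T α) (fun _ hp h => h.reveal hp)
    (fun _ hp h => h.record_none hp) fun _ hp h => h.exists_record_some h0 h1 hp

end Painter

end OnlineGame

namespace HypergraphRamsey

open Finset OnlineGame

section RamseyNumber

variable {k n : ℕ} {V W : Type} {F : KGraph k V} {G : KGraph k W}

theorem arrows_ramseyNumber (h : Arrows n F G) : Arrows (ramseyNumber F G) F G :=
  Nat.sInf_mem (s := {n | Arrows n F G}) ⟨n, h⟩

theorem ramseyNumber_le (h : Arrows n F G) : ramseyNumber F G ≤ n :=
  Nat.sInf_le h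

end RamseyNumber

/-- The ordered graph `F` contains the two least vertices of every edge of the triple system `H`,
which has one more vertex. Then `F` is what builder has to force in order to obtain `H`. -/
def KGraph.LeastPairsAdj {k : ℕ} (H : KGraph 3 (Fin (k + 1))) (F : SimpleGraph (Fin k)) : Prop :=
  ∀ (x y : Fin k) (z : Fin (k + 1)), x < y → y.castSucc < z →
    {x.castSucc, y.castSucc, z} ∈ H.edges → F.Adj x y

theorem leastPairsAdj_top {k : ℕ} (H : KGraph 3 (Fin (k + 1))) : H.LeastPairsAdj ⊤ :=
  fun _ _ _ hxy _ _ => hxy.ne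

theorem K5minus_leastPairsAdj_K4minus : K5minus.LeastPairsAdj K4minus := by
  intro x y z hxy hyz he
  refine SimpleGraph.deleteEdges_adj.2 ⟨hxy.ne, fun hs => he.2 ?_⟩
  obtain ⟨rfl, rfl⟩ | ⟨rfl, rfl⟩ := Sym2.eq_iff.1 (Set.mem_singleton_iff.1 hs)
  · obtain rfl : z = 4 := Fin.last_le_iff.1 hyz
    rfl
  · exact absurd hxy (by decide)

theorem exists_lt_lt_of_card_eq_three {ι : Type*} [LinearOrder ι] {e : Finset ι} (he : #e = 3) :
    ∃ x y z, x < y ∧ y < z ∧ e = {x, y, z} := by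
  have hmono := (e.orderEmbOfFin he).strictMono
  refine ⟨_, _, _, hmono (show (0 : Fin 3) < 1 by decide),
    hmono (show (1 : Fin 3) < 2 by decide), ?_⟩
  simpa [Fin.univ_succ] using (e.image_orderEmbOfFin_univ he).symm

theorem strictMono_snoc {k : ℕ} {β : Type*} [Preorder β] {f : Fin k → β} {b : β}
    (hf : StrictMono f) (hb : ∀ x, f x < b) :
    StrictMono (Fin.snoc f b : Fin (k + 1) → β) := by
  intro x y hxy
  obtain ⟨x, rfl⟩ := Fin.exists_castSucc_eq.2 (hxy.trans_le (Fin.le_last y)).ne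
  rw [Fin.snoc_castSucc]
  induction y using Fin.lastCases with
  | last => simpa only [Fin.snoc_last] using hb x
  | cast y => simpa only [Fin.snoc_castSucc] using hf (Fin.castSucc_lt_castSucc_iff.1 hxy)

theorem hasMonoCopy_of_realizes {N k : ℕ} {χ : Coloring 3 N} {p : Position} {d : Color}
    {F : SimpleGraph (Fin k)} {H : KGraph 3 (Fin (k + 1))} (hHF : H.LeastPairsAdj F)
    {v : ℕ → Fin N}
    (hv : Realizes (Function.extend Subtype.val χ fun _ => .red) p.color v (p.vertices + 1))
    (h : p.HasOrderedCopy d F) : HasMonoCopy χ d H := by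
  obtain ⟨f, hf, hlt, hcolor⟩ := h
  let g : Fin (k + 1) → ℕ := Fin.snoc f p.vertices
  have hg : StrictMono g := strictMono_snoc hf hlt
  have hgf : ∀ x : Fin k, g x.castSucc = f x := fun x => Fin.snoc_castSucc _ _ x
  have hg_lt : ∀ z, g z < p.vertices + 1 := fun z =>
    (hg.monotone (Fin.le_last z)).trans_lt (by simp [g])
  have hinj : Function.Injective (v ∘ g) :=
    .of_lt_imp_ne fun _ z hyz => hv.ne (hg hyz) (hg_lt z)
  refine ⟨⟨v ∘ g, hinj⟩, fun e he => ?_⟩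
  rw [← Subtype.val_injective.extend_apply χ fun _ => .red]
  obtain ⟨x, y, z, hxy, hyz, rfl⟩ := exists_lt_lt_of_card_eq_three (H.uniform e he)
  obtain ⟨y, rfl⟩ := Fin.exists_castSucc_eq.2 (hyz.trans_le (Fin.le_last z)).ne
  obtain ⟨x, rfl⟩ := Fin.exists_castSucc_eq.2 (hxy.trans_le (Fin.le_last _)).ne
  have hxy' : x < y := Fin.castSucc_lt_castSucc_iff.1 hxy
  have hdrawn : p.color (g x.castSucc) (g y.castSucc) = some d := by
    rw [hgf, hgf]
    exact hcolor x y hxy' (hHF x y z hxy' hyz he)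
  simpa only [map_insert, map_singleton] using!
    hv.color_eq (hg hxy) (hg hyz) (hg_lt z) hdrawn

theorem arrows_of_builderEnsures {k s ℓ a m N : ℕ} {F : SimpleGraph (Fin k)}
    {H : KGraph 3 (Fin (k + 1))} (hHF : H.LeastPairsAdj F) (h : BuilderEnsures F s ℓ a m)
    (G : KGraph 3 (Fin (s + 1))) {α : ℝ} (h0 : 0 ≤ α) (h1 : α ≤ 1 / 2)
    (hN : (ℓ : ℝ) < N * ((α / (1 - α)) ^ a * (1 - α) ^ m)) :
    Arrows N H G := by
  intro χ
  obtain ⟨τ, hτ⟩ := exists_painter_forall_realizable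
    (Function.extend Subtype.val χ fun _ => .red) h0 (by linarith)
  obtain ⟨σ, hσ⟩ := h
  obtain ⟨n, hcopy, hℓ, ha, hm⟩ := hσ τ
  have hcard : ((play σ τ n).vertices : ℝ) <
      Fintype.card (Fin N) * (play σ τ n).weight α :=
    calc ((play σ τ n).vertices : ℝ) ≤ ℓ := Nat.cast_le.2 hℓ
      _ < N * ((α / (1 - α)) ^ a * (1 - α) ^ m) := hN
      _ ≤ N * (play σ τ n).weight α :=
          mul_le_mul_of_nonneg_left (Position.le_weight h0 h1 ha hm) (Nat.cast_nonneg N)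
      _ = Fintype.card (Fin N) * (play σ τ n).weight α := by rw [Fintype.card_fin]
  obtain ⟨v, hv, -⟩ := (hτ σ n).exists_realizes_succ hcard
  exact hcopy.imp (hasMonoCopy_of_realizes hHF hv)
    (hasMonoCopy_of_realizes (leastPairsAdj_top G) hv)

theorem zpow_neg_mul_zpow_sub {α β : ℝ} (hβ : β ≠ 0) (a m : ℕ) :
    α ^ (-(a : ℤ)) * β ^ ((a : ℤ) - m) = ((α / β) ^ a * β ^ m)⁻¹ := by
  rw [zpow_neg, zpow_sub₀ hβ, div_pow]
  simp only [zpow_natCast]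
  field_simp

end HypergraphRamsey

open HypergraphRamsey OnlineGame in
theorem theorem5_general {k s ℓ a m : ℕ} (hk : 0 < k) (hs : 0 < s) {F : SimpleGraph (Fin k)}
    {H : KGraph 3 (Fin (k + 1))} (hHF : H.LeastPairsAdj F) (h : BuilderEnsures F s ℓ a m)
    (G : KGraph 3 (Fin (s + 1))) {α : ℝ} (h0 : 0 < α) (h1 : α ≤ 1 / 2) :
    Arrows (ramseyNumber H G) H G ∧
      (ramseyNumber H G : ℝ) ≤ 2 * (ℓ * α ^ (-(a : ℤ)) * (1 - α) ^ ((a : ℤ) - (m : ℤ))) := by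
  have hβ : 0 < 1 - α := by linarith
  set ρ : ℝ := (α / (1 - α)) ^ a * (1 - α) ^ m with hρ
  have hρ0 : 0 < ρ := by positivity
  have hρ1 : ρ ≤ 1 := mul_le_one₀
    (pow_le_one₀ (by positivity) (div_one_sub_le_one h1)) (by positivity)
    (pow_le_one₀ hβ.le (by linarith))
  have hℓ : (1 : ℝ) ≤ ℓ := by exact_mod_cast h.vertices_pos hk hs
  have harrows : Arrows (⌊ℓ / ρ⌋₊ + 1) H G := by
    refine arrows_of_builderEnsures hHF h G h0.le h1 ((div_lt_iff₀ hρ0).1 ?_)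
    exact_mod_cast Nat.lt_floor_add_one (ℓ / ρ)
  refine ⟨arrows_ramseyNumber harrows, ?_⟩
  rw [mul_assoc (ℓ : ℝ), zpow_neg_mul_zpow_sub hβ.ne', ← hρ, ← div_eq_mul_inv]
  calc (ramseyNumber H G : ℝ) ≤ (⌊ℓ / ρ⌋₊ + 1 : ℕ) := Nat.cast_le.2 (ramseyNumber_le harrows)
    _ = ⌊ℓ / ρ⌋₊ + 1 := Nat.cast_succ _
    _ ≤ ℓ / ρ + ℓ / ρ :=
        add_le_add (Nat.floor_le (by positivity)) ((one_le_div hρ0).2 (hρ1.trans hℓ))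
    _ = 2 * (ℓ / ρ) := (two_mul _).symm

theorem theorem5 :
    ∃ C : ℝ, 0 < C ∧ ∀ t ℓ a m : ℕ, 2 ≤ t →
      OnlineGame.BuilderEnsures OnlineGame.K4minus (t - 1) ℓ a m →
      ∀ α : ℝ, 0 < α → α < 1 / 2 →
        HypergraphRamsey.Arrows
            (HypergraphRamsey.ramseyNumber HypergraphRamsey.K5minus (HypergraphRamsey.complete 3 t))
            HypergraphRamsey.K5minus (HypergraphRamsey.complete 3 t) ∧
        (HypergraphRamsey.ramseyNumber HypergraphRamsey.K5minus
            (HypergraphRamsey.complete 3 t) : ℝ) ≤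
          C * ((ℓ : ℝ) * α ^ (-(a : ℤ)) * (1 - α) ^ ((a : ℤ) - (m : ℤ))) := by
  refine ⟨2, two_pos, fun t ℓ a m ht h α h0 h1 => ?_⟩
  obtain ⟨s, rfl⟩ : ∃ s, t = s + 1 := ⟨t - 1, by omega⟩
  exact theorem5_general (by decide) (by omega) HypergraphRamsey.K5minus_leastPairsAdj_K4minus h
    (HypergraphRamsey.complete 3 (s + 1)) h0 h1.le
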